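/- Let $0<m\le L$, $\kappa_f=L/m$, $\rho=(L-m)/(L+m)$, and $\rho_{\mathrm{syn}}=1-\frac{2}{\kappa_f+1}$ (so $\rho_{\mathrm{syn}}=\rho\in[0,1)$). Let $E\in\mathbb R^{n\times n}$ be symmetric positive semidefinite, with all of its nonzero singular values in the interval $(2/\kappa_f,\,1]$, and put $W=I-E$. Then there is a constant $M>0$, depending only on $m$, $L$ and $E$, such that the following holds for every differentiable $m$-strongly convex function $f:\mathbb R^n\to\mathbb R$ whose gradient is $L$-Lipschitz continuous. The problem of minimizing $f(x)$ subject to $Ex=0$ has a unique solution $x^\star$, and for every $x^0\in\mathbb R^n$ the iterates of $$u^k=x^k-\tfrac{1-\rho}{m}\nabla f(x^k),\qquad y^k=W(y^{k-1}+u^k)-\rho^2u^{k-1},\qquad x^{k+1}=\rho^2x^k+y^k-y^{k-1}\qquad(k\ge 0),$$ with $y^{-1}=u^{-1}=0$ (note that $\tfrac{1-\rho}{m}=\tfrac{2}{L+m}$), satisfy $$\|x^k-x^\star\|\le M\,\bigl(\|x^0-x^\star\|+\|x^\star\|+\|\nabla f(x^\star)\|\bigr)\,\rho_{\mathrm{syn}}^{\,k}\qquad\text{for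 all }k\ge 0,$$ where $0^0=1$. Hence the algorithm converges linearly with a rate of at least $\rho_{\mathrm{syn}}$, which does not depend on the condition number of $E$. -/

import Mathlib

noncomputable section

namespace ConstrainedSynthesis

/-- `ℝⁿ` with the Euclidean norm. -/
abbrev Vec (n : ℕ) : Type := EuclideanSpace ℝ (Fin n)

/-- The objective is differentiable, `m`-strongly convex, and its gradient is `L`-Lipschitz. -/
structure IsStronglyConvexSmooth {n : ℕ} (m L : ℝ) (f : Vec n → ℝ) : Prop where
  differentiable : Differentiable ℝ f
  strongConvex : StrongConvexOn Set.univ m f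
  lipschitz_gradient : ∀ x y : Vec n, ‖gradient f x - gradient f y‖ ≤ L * ‖x - y‖

/-- The feasible set `{x | E x = 0}`. -/
def feasible {n : ℕ} (E : Matrix (Fin n) (Fin n) ℝ) : Set (Vec n) :=
  {x | Matrix.toEuclideanLin E x = 0}

/-- `xs` solves: minimize `f x` subject to `E x = 0`. -/
def IsSolution {n : ℕ} (f : Vec n → ℝ) (E : Matrix (Fin n) (Fin n) ℝ) (xs : Vec n) : Prop :=
  xs ∈ feasible E ∧ IsMinOn f (feasible E) xs

/-- The parameter `ρ = (L - m) / (L + m)` of the algorithm. -/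
def rho (m L : ℝ) : ℝ := (L - m) / (L + m)

/-- The guaranteed rate `1 - 2 / (κ + 1)`, where `κ = L / m`. -/
def rhoSyn (m L : ℝ) : ℝ := 1 - 2 / (L / m + 1)

/-- What the algorithm stores before step `k`: `x^k`, `y^{k-1}` and `u^{k-1}`. -/
structure State (n : ℕ) where
  x : Vec n
  yPrev : Vec n
  uPrev : Vec n

/-- `u^k = x^k - (2 / (L + m)) ∇f(x^k)`; the step size `2 / (L + m)` equals `(1 - ρ) / m`. -/
def nextU {n : ℕ} (m L : ℝ) (f : Vec n → ℝ) (s : State n) : Vec n :=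
  s.x - (2 / (L + m)) • gradient f s.x

/-- `y^k = W (y^{k-1} + u^k) - ρ² u^{k-1}` with `W = I - E`. -/
def nextY {n : ℕ} (m L : ℝ) (E : Matrix (Fin n) (Fin n) ℝ) (f : Vec n → ℝ) (s : State n) :
    Vec n :=
  Matrix.toEuclideanLin (1 - E) (s.yPrev + nextU m L f s) - (rho m L) ^ 2 • s.uPrev

/-- One iteration; `x^{k+1} = ρ² x^k + y^k - y^{k-1}`. -/
def step {n : ℕ} (m L : ℝ) (E : Matrix (Fin n) (Fin n) ℝ) (f : Vec n → ℝ) (s : State n) :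
    State n where
  x := (rho m L) ^ 2 • s.x + nextY m L E f s - s.yPrev
  yPrev := nextY m L E f s
  uPrev := nextU m L f s

/-- The state before step `k`, started from `x^0 = x0` and `y^{-1} = u^{-1} = 0`. -/
def state {n : ℕ} (m L : ℝ) (E : Matrix (Fin n) (Fin n) ℝ) (f : Vec n → ℝ) (x0 : Vec n) :
    ℕ → State n
  | 0 => ⟨x0, 0, 0⟩
  | k + 1 => step m L E f (state m L E f x0 k)

/-- The iterate `x^k`. -/
def iterate {n : ℕ} (m L : ℝ) (E : Matrix (Fin n) (Fin n) ℝ) (f : Vec n → ℝ) (x0 : Vec n)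
    (k : ℕ) : Vec n :=
  (state m L E f x0 k).x

end ConstrainedSynthesis

end

/-!
In an orthonormal eigenbasis of `E`, the linear part of the algorithm splits into scalar filters
from `u` to `x`. Along an eigenvector with eigenvalue `μ`, with `a = 1 - μ`, the filter is the
product of `(a z - ρ²) / (z - a)`, which takes `u` to `y`, and of `(z - 1) / (z (z - ρ²))`, which
takes `y` to `x`. On the circle `|z| = ρ` these factors have the constant moduli `ρ` and `1 / ρ²`,
so the filter has gain exactly `1 / ρ` there. For `μ ≠ 0` the hypothesis on the singular values
gives `0 ≤ a < ρ`, hence its poles `0`, `ρ²`, `a` lie inside the circle. The gradient step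
`x ↦ x - 2 / (L + m) ∇f x` is `ρ`-Lipschitz (`norm_gradient_step_sub_le`), so the loop gain is
exactly `1` in the norm weighted by `ρ^(-k)`. A small-gain theorem does not apply at gain `1`, but
an all-pass filter has an explicit storage function with an exact energy balance
(`modeEnergy_step`), and the sum of these over all modes decreases by the factor
`ρ²` per step.

The kernel of `E` is exceptional: there the filter reduces to `1 / z`, the pole `ρ²` is cancelled,
and the initial state adds `ρ^(2k+2) x^0` to `x^(k+1)` (`inner_x_sub_inner_uPrev`). The energy
controls only `x` in these modes, and the geometric perturbation is absorbed by Minkowski's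
inequality (`stateEnergy_step_le`).

The solution is the fixed point of the gradient step followed by the projection onto the kernel
of `E` (`exists_mem_ker_inner_gradient_eq_zero`). At this point `∇f` is orthogonal to the kernel,
which makes it an equilibrium of the filters in every mode.
-/

namespace ConstrainedSynthesis

open scoped RealInnerProductSpace

/-! ### Gradient inequalities -/

section Gradient

variable {V : Type*} [NormedAddCommGroup V] [InnerProductSpace ℝ V]

theorem hasDerivAt_comp_lineMap [CompleteSpace V] {h : V → ℝ} {g : V → V}
    (hg : ∀ x, HasGradientAt h (g x) x) (x y : V) (t : ℝ) :
    HasDerivAt (fun s : ℝ => h (AffineMap.lineMap x y s))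
      ⟪g (AffineMap.lineMap x y t), y - x⟫ t := by
  have := (hg (AffineMap.lineMap x y t)).hasFDerivAt.comp_hasDerivAt t
    (AffineMap.hasDerivAt_lineMap (a := x) (b := y) (x := t))
  simpa [Function.comp_def] using this

theorem add_inner_gradient_le_of_convexOn [CompleteSpace V] {h : V → ℝ} {g : V → V}
    (hc : ConvexOn ℝ Set.univ h) (hg : ∀ x, HasGradientAt h (g x) x) (x y : V) :
    h x + ⟪g x, y - x⟫ ≤ h y := by
  have h1 : ConvexOn ℝ Set.univ (fun s : ℝ => h (AffineMap.lineMap x y s)) := by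
    simpa [Function.comp_def] using hc.comp_affineMap (AffineMap.lineMap x y)
  have h2 := h1.le_slope_of_hasDerivAt (Set.mem_univ 0) (Set.mem_univ 1) one_pos
    (hasDerivAt_comp_lineMap hg x y 0)
  simp only [slope_def_field, AffineMap.lineMap_apply_zero, AffineMap.lineMap_apply_one] at h2
  linarith

/-- The descent lemma. -/
theorem le_add_inner_gradient_of_lipschitz [CompleteSpace V] {f : V → ℝ} {g : V → V} {L : ℝ}
    (hg : ∀ x, HasGradientAt f (g x) x) (hL : ∀ x y, ‖g x - g y‖ ≤ L * ‖x - y‖) (x y : V) :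
    f y ≤ f x + ⟪g x, y - x⟫ + L / 2 * ‖y - x‖ ^ 2 := by
  -- Along the segment, the value minus the quadratic upper model has a nonpositive derivative.
  let ψ : ℝ → ℝ := fun t =>
    f (AffineMap.lineMap x y t) - t * ⟪g x, y - x⟫ - L / 2 * ‖y - x‖ ^ 2 * t ^ 2
  have hd (t : ℝ) : HasDerivAt ψ
      (⟪g (AffineMap.lineMap x y t), y - x⟫ - 1 * ⟪g x, y - x⟫
        - L / 2 * ‖y - x‖ ^ 2 * (2 * t)) t := by
    refine ((hasDerivAt_comp_lineMap hg x y t).sub ((hasDerivAt_id t).mul_const _)).sub ?_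
    simpa using (hasDerivAt_pow 2 t).const_mul (L / 2 * ‖y - x‖ ^ 2)
  have hanti : AntitoneOn ψ (Set.Icc 0 1) := by
    refine antitoneOn_of_deriv_nonpos (convex_Icc 0 1)
      (fun t _ => (hd t).continuousAt.continuousWithinAt)
      (fun t _ => (hd t).differentiableAt.differentiableWithinAt) fun t ht => ?_
    rw [interior_Icc] at ht
    rw [(hd t).deriv]
    have h1 := hL (AffineMap.lineMap x y t) x
    have h2 : AffineMap.lineMap x y t - x = t • (y - x) := by
      simp [AffineMap.lineMap_apply]
    rw [h2, norm_smul, Real.norm_of_nonneg ht.1.le] at h1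
    have h3 := real_inner_le_norm (g (AffineMap.lineMap x y t) - g x) (y - x)
    rw [inner_sub_left] at h3
    have h4 := mul_le_mul_of_nonneg_right h1 (norm_nonneg (y - x))
    nlinarith
  have h0 := hanti (Set.left_mem_Icc.2 zero_le_one) (Set.right_mem_Icc.2 zero_le_one) zero_le_one
  simp only [ψ, AffineMap.lineMap_apply_zero, AffineMap.lineMap_apply_one] at h0
  linarith

/-- Baillon–Haddad: the gradient of a convex function with a quadratic upper model of curvature
`K` is cocoercive. Multiplying by `K` instead of dividing covers `K = 0`. -/
theorem norm_sq_gradient_sub_le {h : V → ℝ} {g : V → V} {K : ℝ} (hK : 0 ≤ K)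
    (hlow : ∀ x y, h x + ⟪g x, y - x⟫ ≤ h y)
    (hup : ∀ x y, h y ≤ h x + ⟪g x, y - x⟫ + K / 2 * ‖y - x‖ ^ 2) (x y : V) :
    ‖g y - g x‖ ^ 2 ≤ K * ⟪g y - g x, y - x⟫ := by
  -- Compare the lower model at `x` with the upper model at `y` in the point `y - t (g y - g x)`.
  have key (x y : V) (t : ℝ) :
      h x + ⟪g x, y - x⟫ + (t - K / 2 * t ^ 2) * ‖g y - g x‖ ^ 2 ≤ h y := by
    have h1 := hlow x (y - t • (g y - g x))
    have h2 := hup y (y - t • (g y - g x))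
    have e1 : y - t • (g y - g x) - x = (y - x) - t • (g y - g x) := by abel
    have e2 : y - t • (g y - g x) - y = -(t • (g y - g x)) := by abel
    rw [e1, inner_sub_right, real_inner_smul_right] at h1
    rw [e2, inner_neg_right, real_inner_smul_right, norm_neg, norm_smul, mul_pow,
      Real.norm_eq_abs, sq_abs] at h2
    have e3 : ⟪g y, g y - g x⟫ - ⟪g x, g y - g x⟫ = ‖g y - g x‖ ^ 2 := by
      rw [← inner_sub_left, real_inner_self_eq_norm_sq]
    linear_combination h1 + h2 - t * e3
  have key2 (t : ℝ) : (2 * t - K * t ^ 2) * ‖g y - g x‖ ^ 2 ≤ ⟪g y - g x, y - x⟫ := by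
    have h1 := key x y t
    have h2 := key y x t
    rw [norm_sub_rev (g x), ← neg_sub y x, inner_neg_right] at h2
    rw [inner_sub_left]
    linarith
  rcases hK.eq_or_lt with rfl | hK
  · by_contra hne
    have hpos : 0 < ‖g y - g x‖ ^ 2 := by linarith
    generalize ‖g y - g x‖ ^ 2 = q at key2 hpos
    generalize ⟪g y - g x, y - x⟫ = c at key2
    have h1 := key2 ((c + 1) / (2 * q))
    have h2 : (2 * ((c + 1) / (2 * q)) - 0 * ((c + 1) / (2 * q)) ^ 2) * q = c + 1 := by
      field_simp
      ring
    linarith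
  · have h1 := mul_le_mul_of_nonneg_left (key2 (1 / K)) hK.le
    have h2 : K * ((2 * (1 / K) - K * (1 / K) ^ 2) * ‖g y - g x‖ ^ 2) = ‖g y - g x‖ ^ 2 := by
      field_simp
      ring
    linarith

theorem hasGradientAt_sub_norm_sq [CompleteSpace V] {f : V → ℝ} {g x : V} (m : ℝ)
    (hg : HasGradientAt f g x) :
    HasGradientAt (fun z => f z - m / 2 * ‖z‖ ^ 2) (g - m • x) x := by
  rw [hasGradientAt_iff_hasFDerivAt] at hg ⊢
  refine (hg.sub ((hasStrictFDerivAt_norm_sq x).hasFDerivAt.const_mul (m / 2))).congr_fderiv ?_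
  ext v
  simp
  ring

/-- A gradient step of length `2 / (L + m)` contracts with the factor `(L - m) / (L + m)`. -/
theorem norm_gradient_step_sub_le [CompleteSpace V] {f : V → ℝ} {g : V → V} {m L : ℝ}
    (hm : 0 < m) (hmL : m ≤ L) (hg : ∀ x, HasGradientAt f (g x) x)
    (hf : StrongConvexOn Set.univ m f)
    (hL : ∀ x y, ‖g x - g y‖ ≤ L * ‖x - y‖) (x y : V) :
    ‖(y - (2 / (L + m)) • g y) - (x - (2 / (L + m)) • g x)‖ ≤ (L - m) / (L + m) * ‖y - x‖ := by
  have hLm : 0 < L + m := by linarith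
  -- Removing the quadratic part leaves a convex function of curvature at most `L - m`.
  have hco := norm_sq_gradient_sub_le (h := fun z => f z - m / 2 * ‖z‖ ^ 2)
    (g := fun z => g z - m • z) (sub_nonneg.2 hmL)
    (add_inner_gradient_le_of_convexOn (strongConvexOn_iff_convex.1 hf)
      fun z => hasGradientAt_sub_norm_sq m (hg z))
    (fun x y => by
      have h1 := le_add_inner_gradient_of_lipschitz hg hL x y
      have h2 : ‖y‖ ^ 2 = ‖x‖ ^ 2 + 2 * ⟪x, y - x⟫ + ‖y - x‖ ^ 2 := by
        have := norm_add_sq_real x (y - x)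
        rwa [add_sub_cancel] at this
      simp only [inner_sub_left, real_inner_smul_left]
      rw [h2]
      linarith) x y
  set e : V := g y - m • y - (g x - m • x) with he
  set d : V := y - x with hd
  have hge : (y - (2 / (L + m)) • g y) - (x - (2 / (L + m)) • g x)
      = ((L - m) / (L + m)) • d - (2 / (L + m)) • e := by
    have : (L - m) / (L + m) = 1 - 2 / (L + m) * m := by field_simp; ring
    rw [this, he, hd]
    module
  rw [hge]
  refine abs_le_of_sq_le_sq' ?_ (by have := sub_nonneg.2 hmL; positivity) |>.2
  rw [norm_sub_sq_real, norm_smul, norm_smul, real_inner_smul_left, real_inner_smul_right,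
    mul_pow, mul_pow, mul_pow, Real.norm_eq_abs, Real.norm_eq_abs, sq_abs, sq_abs,
    real_inner_comm]
  have : (2 / (L + m)) ^ 2 * ‖e‖ ^ 2 ≤ (2 / (L + m)) ^ 2 * ((L - m) * ⟪e, d⟫) :=
    mul_le_mul_of_nonneg_left hco (by positivity)
  have e2 : 2 * ((L - m) / (L + m) * (2 / (L + m) * ⟪e, d⟫))
      = (2 / (L + m)) ^ 2 * ((L - m) * ⟪e, d⟫) := by
    field_simp
  linarith

end Gradient

/-! ### The constrained problem -/

section Problem

variable {n : ℕ} {m L : ℝ} {f : Vec n → ℝ}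

theorem IsStronglyConvexSmooth.hasGradientAt (hf : IsStronglyConvexSmooth m L f) (x : Vec n) :
    HasGradientAt f (gradient f x) x :=
  (hf.differentiable x).hasGradientAt

theorem IsStronglyConvexSmooth.norm_step_sub_le (hm : 0 < m) (hmL : m ≤ L)
    (hf : IsStronglyConvexSmooth m L f) (x y : Vec n) :
    ‖(y - (2 / (L + m)) • gradient f y) - (x - (2 / (L + m)) • gradient f x)‖
      ≤ rho m L * ‖y - x‖ :=
  norm_gradient_step_sub_le hm hmL hf.hasGradientAt hf.strongConvex hf.lipschitz_gradient x y

/-- The first-order optimality conditions have a solution: it is the fixed point of the gradient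
step followed by the projection onto the kernel, which is a contraction. -/
theorem exists_mem_ker_inner_gradient_eq_zero (hm : 0 < m) (hmL : m ≤ L)
    (hf : IsStronglyConvexSmooth m L f) (K : Submodule ℝ (Vec n)) :
    ∃ xs ∈ K, ∀ v ∈ K, ⟪gradient f xs, v⟫ = 0 := by
  have hLm : 0 < L + m := by linarith
  have h0 : 0 ≤ rho m L := div_nonneg (by linarith) hLm.le
  have h1 : rho m L < 1 := (div_lt_one hLm).2 (by linarith)
  let F : Vec n → Vec n := fun x => K.starProjection (x - (2 / (L + m)) • gradient f x)
  have hF : ContractingWith ⟨rho m L, h0⟩ F := by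
    refine ⟨by exact_mod_cast h1, LipschitzWith.of_dist_le_mul fun x y => ?_⟩
    rw [dist_eq_norm, dist_eq_norm, ← map_sub]
    exact (K.norm_starProjection_apply_le _).trans (hf.norm_step_sub_le hm hmL y x)
  have hfix : F hF.fixedPoint = hF.fixedPoint := hF.fixedPoint_isFixedPt
  refine ⟨hF.fixedPoint, by rw [← hfix]; exact K.starProjection_apply_mem _, fun v hv => ?_⟩
  have h2 := K.starProjection_inner_eq_zero
    (hF.fixedPoint - (2 / (L + m)) • gradient f hF.fixedPoint) v hv
  have h3 : K.starProjection (hF.fixedPoint - (2 / (L + m)) • gradient f hF.fixedPoint)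
      = hF.fixedPoint := hfix
  rw [h3, sub_sub_cancel_left, inner_neg_left, real_inner_smul_left, neg_eq_zero] at h2
  exact (mul_eq_zero.1 h2).resolve_left (by positivity)

theorem isSolution_of_inner_gradient_eq_zero (hm : 0 < m) (hf : IsStronglyConvexSmooth m L f)
    {E : Matrix (Fin n) (Fin n) ℝ} {xs : Vec n} (hxs : Matrix.toEuclideanLin E xs = 0)
    (hg : ∀ v, Matrix.toEuclideanLin E v = 0 → ⟪gradient f xs, v⟫ = 0) : IsSolution f E xs := by
  refine ⟨hxs, fun z hz => ?_⟩
  have h1 := add_inner_gradient_le_of_convexOn (hf.strongConvex.strictConvexOn hm).convexOn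
    hf.hasGradientAt xs z
  have hz' : Matrix.toEuclideanLin E z = 0 := hz
  rw [hg (z - xs) (by rw [map_sub, hz', hxs, sub_zero]), add_zero] at h1
  exact h1

theorem IsSolution.unique (hm : 0 < m) (hf : IsStronglyConvexSmooth m L f)
    {E : Matrix (Fin n) (Fin n) ℝ} {x z : Vec n} (hx : IsSolution f E x) (hz : IsSolution f E z) :
    z = x :=
  have hker : Convex ℝ (feasible E) := (LinearMap.ker (Matrix.toEuclideanLin E)).convex
  ((hf.strongConvex.strictConvexOn hm).subset (Set.subset_univ _) hker).eq_of_isMinOn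
    hz.2 hx.2 hz.1 hx.1

end Problem

/-! ### Eigenvalues and singular values -/

/-- A positive semidefinite matrix is diagonal in an orthonormal basis, and its nonzero eigenvalues
are singular values. -/
theorem exists_orthonormalBasis_eigenvalues {n : ℕ} {E : Matrix (Fin n) (Fin n) ℝ}
    (hE : E.PosSemidef) :
    ∃ (b : OrthonormalBasis (Fin n) ℝ (Vec n)) (μ : Fin n → ℝ),
      (∀ i v, ⟪b i, Matrix.toEuclideanLin E v⟫ = μ i * ⟪b i, v⟫) ∧
      ∀ i, ∃ j : ℕ, (Matrix.toEuclideanLin E).singularValues j = μ i := by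
  set T := Matrix.toEuclideanLin E with hT
  have hsymm : T.IsSymmetric := Matrix.isSymmetric_toEuclideanLin_iff.2 hE.isHermitian
  have hn : Module.finrank ℝ (Vec n) = n := by simp
  have hev (i : Fin n) : T (hsymm.eigenvectorBasis hn i)
      = hsymm.eigenvalues hn i • hsymm.eigenvectorBasis hn i := by
    simp
  refine ⟨hsymm.eigenvectorBasis hn, hsymm.eigenvalues hn, fun i v => ?_, fun i => ?_⟩
  · rw [← hsymm, hev, real_inner_smul_left]
  · have hadj : LinearMap.adjoint T = T :=
      (LinearMap.isSymmetric_iff_isSelfAdjoint T).1 hsymm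
    have hnonneg : 0 ≤ hsymm.eigenvalues hn i :=
      (Matrix.isPositive_toEuclideanLin_iff.2 hE).nonneg_eigenvalues hn i
    have h2 : Module.End.HasEigenvalue (LinearMap.adjoint T ∘ₗ T) (hsymm.eigenvalues hn i ^ 2) := by
      refine Module.End.hasEigenvalue_of_hasEigenvector (x := hsymm.eigenvectorBasis hn i)
        ⟨Module.End.mem_eigenspace_iff.2 ?_, (hsymm.hasEigenvector_eigenvectorBasis hn i).2⟩
      rw [hadj, LinearMap.comp_apply, hev, map_smul, hev, smul_smul, sq]
    obtain ⟨j, hj⟩ := T.isSymmetric_adjoint_comp_self.exists_eigenvalues_eq hn h2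
    refine ⟨j, ?_⟩
    rw [T.singularValues_fin hn]
    have hj' : T.isSymmetric_adjoint_comp_self.eigenvalues hn j = hsymm.eigenvalues hn i ^ 2 := by
      simpa using hj
    rw [hj', Real.sqrt_sq hnonneg]

/-! ### The energy of a single mode -/

/-- Energy of the deviation `(X, Y, U)` of `(x^k, y^{k-1}, u^{k-1})` from equilibrium along an
eigenvector of `E` with eigenvalue `μ`, where `r = ρ`. For `μ ≠ 0` the last two summands are
scaled storage functions of the filters taking `y` to `x` and `u` to `y`. For `μ = 0` only `x`
counts: there `y` may grow without bound. -/
noncomputable def modeEnergy (r μ X Y U : ℝ) : ℝ :=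
  if μ = 0 then X ^ 2
  else X ^ 2 + (r ^ 2 * X - Y) ^ 2 / (r ^ 2 * (1 - r ^ 2)) +
    ((1 - μ) * Y - r ^ 2 * U) ^ 2 / (r ^ 2 * (r ^ 2 - (1 - μ) ^ 2))

/-- A constant bounding the energy of a mode that starts from `y = u = 0`, when its initial
deviation is at most `1` and the equilibrium value of `u` is at most `e`. -/
noncomputable def initialModeBound (r μ e : ℝ) : ℝ :=
  if μ = 0 then 1
  else 1 + (r ^ 2 + |(1 - μ - r ^ 2) / μ| * e) ^ 2 / (r ^ 2 * (1 - r ^ 2)) +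
    (|1 - μ| * (|(1 - μ - r ^ 2) / μ| * e) + r ^ 2 * e) ^ 2 / (r ^ 2 * (r ^ 2 - (1 - μ) ^ 2))

section Mode

variable {r μ : ℝ}

theorem modeEnergy_denominators_pos (h1 : r < 1) (hμ : 1 - r < μ ∧ μ ≤ 1) :
    0 < r ∧ 0 < r ^ 2 * (1 - r ^ 2) ∧ 0 < r ^ 2 * (r ^ 2 - (1 - μ) ^ 2) := by
  obtain ⟨ha, hb⟩ := hμ
  have hr : 0 < r := by linarith
  have h2 : 0 < 1 - r ^ 2 := by nlinarith
  have h3 : 0 < r ^ 2 - (1 - μ) ^ 2 := by nlinarith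
  exact ⟨hr, by positivity, by positivity⟩

theorem sq_le_modeEnergy (h1 : r < 1) (hμ : μ = 0 ∨ 1 - r < μ ∧ μ ≤ 1) (X Y U : ℝ) :
    X ^ 2 ≤ modeEnergy r μ X Y U := by
  unfold modeEnergy
  split_ifs with h
  · exact le_rfl
  · obtain ⟨-, h2, h3⟩ := modeEnergy_denominators_pos h1 (hμ.resolve_left h)
    rw [add_assoc, le_add_iff_nonneg_right]
    positivity

/-- Energy balance along a mode: both filters are all-pass on the circle of radius `r`, so nothing
is lost. The summand `p` is the trace of the initial state, present only in the kernel of `E`. -/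
theorem modeEnergy_step (h1 : r < 1) (hμ : μ = 0 ∨ 1 - r < μ ∧ μ ≤ 1)
    {X Y U X' Y' U' p : ℝ} (h0 : μ = 0 → X' = U' + p) (hp : μ ≠ 0 → p = 0)
    (hY : μ ≠ 0 → Y' = (1 - μ) * (Y + U') - r ^ 2 * U)
    (hX : μ ≠ 0 → X' = r ^ 2 * X + Y' - Y) :
    modeEnergy r μ X' Y' U' = r ^ 2 * (modeEnergy r μ X Y U - X ^ 2) + (U' + p) ^ 2 := by
  unfold modeEnergy
  split_ifs with h
  · rw [h0 h]
    ring
  · obtain ⟨hr, h2, h3⟩ := modeEnergy_denominators_pos h1 (hμ.resolve_left h)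
    have h2' : 1 - r ^ 2 ≠ 0 := right_ne_zero_of_mul h2.ne'
    have h3' : r ^ 2 - (1 - μ) ^ 2 ≠ 0 := right_ne_zero_of_mul h3.ne'
    rw [hX h, hY h, hp h]
    generalize 1 - μ = a at h3' ⊢
    field_simp
    ring

theorem modeEnergy_initial_le (h1 : r < 1) (hμ : μ = 0 ∨ 1 - r < μ ∧ μ ≤ 1) {X u D e : ℝ}
    (hX : |X| ≤ D) (hu : |u| ≤ e * D) :
    modeEnergy r μ X (0 - (1 - μ - r ^ 2) / μ * u) (0 - u) ≤ initialModeBound r μ e * D ^ 2 := by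
  unfold modeEnergy initialModeBound
  split_ifs with h
  · rw [one_mul]
    exact sq_le_sq' (abs_le.1 hX).1 (abs_le.1 hX).2
  · obtain ⟨hr, h2, h3⟩ := modeEnergy_denominators_pos h1 (hμ.resolve_left h)
    generalize (1 - μ - r ^ 2) / μ = t
    have hY : |t * u| ≤ |t| * e * D := by
      rw [abs_mul, mul_assoc]
      exact mul_le_mul_of_nonneg_left hu (abs_nonneg t)
    have e1 : X ^ 2 ≤ D ^ 2 := sq_le_sq' (abs_le.1 hX).1 (abs_le.1 hX).2
    have e2 : (r ^ 2 * X - (0 - t * u)) ^ 2 ≤ (r ^ 2 + |t| * e) ^ 2 * D ^ 2 := by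
      rw [← mul_pow, sq_le_sq]
      refine le_trans ?_ (le_abs_self _)
      have h4 := abs_add_le (r ^ 2 * X) (t * u)
      rw [abs_mul, abs_of_nonneg (sq_nonneg r)] at h4
      have h5 := mul_le_mul_of_nonneg_left hX (sq_nonneg r)
      rw [zero_sub, sub_neg_eq_add]
      linarith
    have e3 : ((1 - μ) * (0 - t * u) - r ^ 2 * (0 - u)) ^ 2
        ≤ (|1 - μ| * (|t| * e) + r ^ 2 * e) ^ 2 * D ^ 2 := by
      rw [← mul_pow, sq_le_sq]
      refine le_trans ?_ (le_abs_self _)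
      have h4 := abs_sub (r ^ 2 * u) ((1 - μ) * (t * u))
      rw [abs_mul, abs_of_nonneg (sq_nonneg r), abs_mul (1 - μ)] at h4
      have h5 := mul_le_mul_of_nonneg_left hu (sq_nonneg r)
      have h6 := mul_le_mul_of_nonneg_left hY (abs_nonneg (1 - μ))
      have h7 : (1 - μ) * (0 - t * u) - r ^ 2 * (0 - u) = r ^ 2 * u - (1 - μ) * (t * u) := by ring
      rw [h7]
      linarith
    rw [add_mul, add_mul, one_mul, div_mul_eq_mul_div, div_mul_eq_mul_div]
    gcongr

theorem initialModeBound_nonneg (h1 : r < 1) (hμ : μ = 0 ∨ 1 - r < μ ∧ μ ≤ 1) (e : ℝ) :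
    0 ≤ initialModeBound r μ e := by
  unfold initialModeBound
  split_ifs with h
  · exact zero_le_one
  · obtain ⟨-, h2, h3⟩ := modeEnergy_denominators_pos h1 (hμ.resolve_left h)
    positivity

end Mode

/-- Minkowski's inequality for `√(A + ∑ uᵢ²)`. -/
theorem add_sum_add_sq_le {ι : Type*} [Fintype ι] {A B Q : ℝ} (hA : 0 ≤ A) (hB : 0 ≤ B)
    (hQ : 0 ≤ Q) {u p : ι → ℝ} (hu : A + ∑ i, u i ^ 2 ≤ B ^ 2) (hp : ∑ i, p i ^ 2 ≤ Q ^ 2) :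
    A + ∑ i, (u i + p i) ^ 2 ≤ (B + Q) ^ 2 := by
  have h1 : ∑ i, u i * p i ≤ B * Q := by
    refine (abs_le_of_sq_le_sq' ?_ (by positivity)).2
    calc (∑ i, u i * p i) ^ 2 ≤ (∑ i, u i ^ 2) * ∑ i, p i ^ 2 :=
          Finset.sum_mul_sq_le_sq_mul_sq _ _ _
      _ ≤ B ^ 2 * Q ^ 2 := by
          gcongr
          linarith
      _ = (B * Q) ^ 2 := (mul_pow B Q 2).symm
  have h2 : ∑ i, (u i + p i) ^ 2 = ∑ i, u i ^ 2 + 2 * ∑ i, u i * p i + ∑ i, p i ^ 2 := by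
    rw [Finset.mul_sum, ← Finset.sum_add_distrib, ← Finset.sum_add_distrib]
    exact Finset.sum_congr rfl fun i _ => by ring
  nlinarith

/-! ### Convergence of the iteration -/

section Convergence

variable {n : ℕ} {m L : ℝ} {E : Matrix (Fin n) (Fin n) ℝ} {f : Vec n → ℝ} {b : Fin n → Vec n}
  {μ : Fin n → ℝ}

theorem inner_nextY (hE : ∀ i v, ⟪b i, Matrix.toEuclideanLin E v⟫ = μ i * ⟪b i, v⟫)
    (s : State n) (i : Fin n) :
    ⟪b i, nextY m L E f s⟫ = (1 - μ i) * (⟪b i, s.yPrev⟫ + ⟪b i, nextU m L f s⟫)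
      - rho m L ^ 2 * ⟪b i, s.uPrev⟫ := by
  have h (v : Vec n) : Matrix.toEuclideanLin (1 - E) v = v - Matrix.toEuclideanLin E v := by
    simp [map_sub]
  rw [nextY, h, inner_sub_right, inner_sub_right, hE, inner_add_right, real_inner_smul_right]
  ring

/-- In the kernel of `E`, the pole `ρ²` of the filter is cancelled: `x^k - u^{k-1}` does not depend
on `f`, and only its initial value `x^0` is felt. -/
theorem inner_x_sub_inner_uPrev
    (hE : ∀ i v, ⟪b i, Matrix.toEuclideanLin E v⟫ = μ i * ⟪b i, v⟫) {i : Fin n} (hi : μ i = 0)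
    (x0 : Vec n) (k : ℕ) :
    ⟪b i, (state m L E f x0 k).x⟫ - ⟪b i, (state m L E f x0 k).uPrev⟫
      = rho m L ^ (2 * k) * ⟪b i, x0⟫ := by
  induction k with
  | zero => simp [state]
  | succ k ih =>
    simp only [state, step]
    rw [inner_sub_right, inner_add_right, real_inner_smul_right, inner_nextY hE, hi,
      mul_add 2 k 1, pow_add, mul_right_comm, ← ih]
    ring

/-- Total energy of a state relative to the equilibrium with `x = xs`. The equilibrium value of `y`
in a mode is the solution `y` of `y = (1 - μ) (y + u) - ρ² u`. For `μ = 0` the quotient has the junk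
value `0`, which `modeEnergy` ignores. -/
noncomputable def stateEnergy (m L : ℝ) (f : Vec n → ℝ) (b : Fin n → Vec n) (μ : Fin n → ℝ)
    (xs : Vec n) (s : State n) : ℝ :=
  ∑ i, modeEnergy (rho m L) (μ i) ⟪b i, s.x - xs⟫
    (⟪b i, s.yPrev⟫ - (1 - μ i - rho m L ^ 2) / μ i * ⟪b i, xs - (2 / (L + m)) • gradient f xs⟫)
    ⟪b i, s.uPrev - (xs - (2 / (L + m)) • gradient f xs)⟫

/-- The root of the energy contracts by `ρ` in each step, up to a summable trace of `x^0`. -/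
theorem stateEnergy_step_le {b : OrthonormalBasis (Fin n) ℝ (Vec n)} (hm : 0 < m) (hmL : m ≤ L)
    (hf : IsStronglyConvexSmooth m L f)
    (hE : ∀ i v, ⟪b i, Matrix.toEuclideanLin E v⟫ = μ i * ⟪b i, v⟫)
    (h1 : rho m L < 1) (hμ : ∀ i, μ i = 0 ∨ 1 - rho m L < μ i ∧ μ i ≤ 1) {xs : Vec n}
    (hg : ∀ i, μ i = 0 → ⟪b i, gradient f xs⟫ = 0) (hxs : ∀ i, μ i ≠ 0 → ⟪b i, xs⟫ = 0)
    (h0 : 0 ≤ rho m L) (x0 : Vec n) (k : ℕ) {B : ℝ} (hB : 0 ≤ B)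
    (hk : stateEnergy m L f b μ xs (state m L E f x0 k) ≤ B ^ 2) :
    stateEnergy m L f b μ xs (state m L E f x0 (k + 1))
      ≤ (rho m L * B + rho m L ^ (2 * (k + 1)) * ‖x0‖) ^ 2 := by
  set s := state m L E f x0 k with hs
  set r := rho m L with hr
  set us := xs - (2 / (L + m)) • gradient f xs with hus
  let X : Fin n → ℝ := fun i => ⟪b i, s.x - xs⟫
  let V : Fin n → ℝ := fun i => modeEnergy r (μ i) ⟪b i, s.x - xs⟫
    (⟪b i, s.yPrev⟫ - (1 - μ i - r ^ 2) / μ i * ⟪b i, us⟫) ⟪b i, s.uPrev - us⟫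
  let p : Fin n → ℝ := fun i => if μ i = 0 then r ^ (2 * (k + 1)) * ⟪b i, x0⟫ else 0
  have hbal : stateEnergy m L f b μ xs (state m L E f x0 (k + 1))
      = ∑ i, r ^ 2 * (V i - X i ^ 2) + ∑ i, (⟪b i, nextU m L f s - us⟫ + p i) ^ 2 := by
    simp only [stateEnergy, ← hus, ← hr]
    rw [← Finset.sum_add_distrib]
    refine Finset.sum_congr rfl fun i _ => ?_
    refine modeEnergy_step h1 (hμ i) (fun hi => ?_) (fun hi => if_neg hi) (fun hi => ?_)
      (fun hi => ?_)
    · have h2 := inner_x_sub_inner_uPrev (m := m) (L := L) (f := f) hE hi x0 (k + 1)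
      have h3 : ⟪b i, us⟫ = ⟪b i, xs⟫ := by
        rw [hus, inner_sub_right, real_inner_smul_right, hg i hi, mul_zero, sub_zero]
      simp only [p, if_pos hi, hr, ← h2, inner_sub_right, h3, state, step, ← hs]
      ring
    · have h2 := inner_nextY (m := m) (L := L) (f := f) hE s i
      simp only [state, step, ← hs, h2, ← hr, inner_sub_right (b i) _ us]
      field_simp
      ring
    · simp only [state, step, ← hs, ← hr, inner_sub_right, inner_add_right, real_inner_smul_right,
        hxs i hi]
      ring
  have hA : 0 ≤ ∑ i, r ^ 2 * (V i - X i ^ 2) :=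
    Finset.sum_nonneg fun i _ => mul_nonneg (sq_nonneg r)
      (sub_nonneg.2 (sq_le_modeEnergy h1 (hμ i) _ _ _))
  rw [hbal]
  refine add_sum_add_sq_le hA (by positivity) (by positivity) ?_ ?_
  · -- The gradient step pays for the outflow: its gain is `r`, that of the linear part is `1 / r`.
    rw [b.sum_sq_inner_right, ← Finset.mul_sum, Finset.sum_sub_distrib]
    have h2 : ‖nextU m L f s - us‖ ≤ r * ‖s.x - xs‖ := hf.norm_step_sub_le hm hmL xs s.x
    have h3 : ‖nextU m L f s - us‖ ^ 2 ≤ r ^ 2 * ∑ i, X i ^ 2 := by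
      rw [b.sum_sq_inner_right, ← mul_pow]
      exact pow_le_pow_left₀ (norm_nonneg _) h2 2
    have h4 : r ^ 2 * ∑ i, V i ≤ r ^ 2 * B ^ 2 := mul_le_mul_of_nonneg_left hk (sq_nonneg r)
    rw [mul_sub, mul_pow]
    linarith
  · rw [mul_pow, ← b.sum_sq_inner_right x0, Finset.mul_sum]
    refine Finset.sum_le_sum fun i _ => ?_
    simp only [p]
    split_ifs
    · rw [mul_pow]
    · rw [zero_pow two_ne_zero]
      positivity

/-- The linear rate, from the optimality conditions written in an eigenbasis of `E`. -/
theorem norm_iterate_sub_le {b : OrthonormalBasis (Fin n) ℝ (Vec n)} (hm : 0 < m) (hmL : m ≤ L)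
    (hf : IsStronglyConvexSmooth m L f)
    (hE : ∀ i v, ⟪b i, Matrix.toEuclideanLin E v⟫ = μ i * ⟪b i, v⟫)
    (h0 : 0 ≤ rho m L) (h1 : rho m L < 1)
    (hμ : ∀ i, μ i = 0 ∨ 1 - rho m L < μ i ∧ μ i ≤ 1) {xs : Vec n}
    (hg : ∀ i, μ i = 0 → ⟪b i, gradient f xs⟫ = 0) (hxs : ∀ i, μ i ≠ 0 → ⟪b i, xs⟫ = 0)
    (x0 : Vec n) (k : ℕ) :
    ‖iterate m L E f x0 k - xs‖
      ≤ (√(∑ i, initialModeBound (rho m L) (μ i) (1 + 2 / (L + m))) + 1 / (1 - rho m L))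
        * (‖x0 - xs‖ + ‖xs‖ + ‖gradient f xs‖) * rho m L ^ k := by
  set r := rho m L with hr
  set K := ∑ i, initialModeBound r (μ i) (1 + 2 / (L + m)) with hK
  set D := ‖x0 - xs‖ + ‖xs‖ + ‖gradient f xs‖ with hD
  have hD0 : 0 ≤ D := by positivity
  have hK0 : 0 ≤ K := Finset.sum_nonneg fun i _ => initialModeBound_nonneg h1 (hμ i) _
  have hr1 : 0 < 1 - r := sub_pos.2 h1
  have hLm : 0 < L + m := by linarith
  have hx0 : ‖x0‖ ≤ D := by
    have := norm_add_le (x0 - xs) xs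
    rw [sub_add_cancel] at this
    have := norm_nonneg (gradient f xs)
    linarith
  -- The subtracted term absorbs the contributions `ρ^(2k+2) ‖x^0‖` of the initial state.
  let B : ℕ → ℝ := fun k => r ^ k * ((√K + 1 / (1 - r)) * D) - r ^ (2 * k) * (‖x0‖ / (1 - r))
  have hB0 (k : ℕ) : 0 ≤ B k := by
    have h2 : r ^ (2 * k) ≤ r ^ k := pow_le_pow_of_le_one h0 h1.le (by omega)
    have h3 : ‖x0‖ / (1 - r) ≤ (√K + 1 / (1 - r)) * D := by
      rw [add_mul, one_div_mul_eq_div]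
      have : ‖x0‖ / (1 - r) ≤ D / (1 - r) := by gcongr
      have : 0 ≤ √K * D := by positivity
      linarith
    have h4 : 0 ≤ ‖x0‖ / (1 - r) := by positivity
    exact sub_nonneg.2 (mul_le_mul h2 h3 h4 (pow_nonneg h0 k))
  have hBsucc (k : ℕ) : r * B k + r ^ (2 * (k + 1)) * ‖x0‖ ≤ B (k + 1) := by
    have h2 : B (k + 1) - (r * B k + r ^ (2 * (k + 1)) * ‖x0‖)
        = r ^ (2 * k + 1) * (1 - r) * ‖x0‖ := by
      simp only [B]
      field_simp
      ring
    have h3 : 0 ≤ r ^ (2 * k + 1) * (1 - r) * ‖x0‖ := by positivity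
    linarith
  have hinit : stateEnergy m L f b μ xs (state m L E f x0 0) ≤ B 0 ^ 2 := by
    have hinner (i : Fin n) (v : Vec n) : |⟪b i, v⟫| ≤ ‖v‖ := by
      simpa using abs_real_inner_le_norm (b i) v
    have hus : ‖xs - (2 / (L + m)) • gradient f xs‖ ≤ (1 + 2 / (L + m)) * D := by
      have h2 := norm_sub_le xs ((2 / (L + m)) • gradient f xs)
      rw [norm_smul, Real.norm_of_nonneg (by positivity)] at h2
      have h3 : ‖xs‖ ≤ D := by
        have := norm_nonneg (gradient f xs)
        have := norm_nonneg (x0 - xs)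
        linarith
      have h4 : ‖gradient f xs‖ ≤ D := by
        have := norm_nonneg xs
        have := norm_nonneg (x0 - xs)
        linarith
      have h5 := mul_le_mul_of_nonneg_left h4 (show 0 ≤ 2 / (L + m) by positivity)
      linarith
    have hx : ‖x0 - xs‖ ≤ D := by
      have := norm_nonneg (gradient f xs)
      have := norm_nonneg xs
      linarith
    have h2 : stateEnergy m L f b μ xs (state m L E f x0 0) ≤ K * D ^ 2 := by
      rw [stateEnergy, hK, Finset.sum_mul]
      refine Finset.sum_le_sum fun i _ => ?_
      have := modeEnergy_initial_le h1 (hμ i) ((hinner i _).trans hx) ((hinner i _).trans hus)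
      simpa only [state, inner_zero_right, inner_sub_right (b i) 0] using this
    have h3 : √K * D ≤ B 0 := by
      have : ‖x0‖ / (1 - r) ≤ D / (1 - r) := by gcongr
      simp only [B, pow_zero, mul_zero, one_mul, add_mul, one_div_mul_eq_div]
      linarith
    calc _ ≤ K * D ^ 2 := h2
      _ = (√K * D) ^ 2 := by rw [mul_pow, Real.sq_sqrt hK0]
      _ ≤ B 0 ^ 2 := pow_le_pow_left₀ (by positivity) h3 2
  have henergy (k : ℕ) : stateEnergy m L f b μ xs (state m L E f x0 k) ≤ B k ^ 2 := by
    induction k with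
    | zero => exact hinit
    | succ k ih =>
      refine (stateEnergy_step_le hm hmL hf hE h1 hμ hg hxs h0 x0 k (hB0 k) ih).trans ?_
      have := hB0 k
      exact pow_le_pow_left₀ (by positivity) (hBsucc k) 2
  have h2 : ‖iterate m L E f x0 k - xs‖ ^ 2 ≤ B k ^ 2 := by
    refine le_trans ?_ (henergy k)
    rw [← b.sum_sq_inner_right]
    exact Finset.sum_le_sum fun i _ => sq_le_modeEnergy h1 (hμ i) _ _ _
  have h3 : ‖iterate m L E f x0 k - xs‖ ≤ B k := (abs_le_of_sq_le_sq' h2 (hB0 k)).2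
  have h4 : 0 ≤ r ^ (2 * k) * (‖x0‖ / (1 - r)) := by positivity
  calc _ ≤ B k := h3
    _ ≤ r ^ k * ((√K + 1 / (1 - r)) * D) := sub_le_self _ h4
    _ = _ := mul_comm _ _

end Convergence

theorem rhoSyn_eq_rho {m L : ℝ} (hm : 0 < m) (hmL : m ≤ L) : rhoSyn m L = rho m L := by
  have : 0 < L + m := by linarith
  unfold rhoSyn rho
  field_simp
  ring

end ConstrainedSynthesis

theorem theorem1 (n : ℕ) (m L : ℝ) (hm : 0 < m) (hmL : m ≤ L)
    (E : Matrix (Fin n) (Fin n) ℝ) (hE : E.PosSemidef)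
    (hσ : ∀ i : ℕ, (Matrix.toEuclideanLin E).singularValues i ≠ 0 →
      (Matrix.toEuclideanLin E).singularValues i ∈ Set.Ioc (2 / (L / m)) 1) :
    0 ≤ ConstrainedSynthesis.rhoSyn m L ∧ ConstrainedSynthesis.rhoSyn m L < 1 ∧
    ∃ M : ℝ, 0 < M ∧
      ∀ f : ConstrainedSynthesis.Vec n → ℝ,
        ConstrainedSynthesis.IsStronglyConvexSmooth m L f →
        ∃ xs : ConstrainedSynthesis.Vec n,
          ConstrainedSynthesis.IsSolution f E xs ∧
          (∀ z : ConstrainedSynthesis.Vec n, ConstrainedSynthesis.IsSolution f E z → z = xs) ∧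
          ∀ (x0 : ConstrainedSynthesis.Vec n) (k : ℕ),
            ‖ConstrainedSynthesis.iterate m L E f x0 k - xs‖ ≤
              M * (‖x0 - xs‖ + ‖xs‖ + ‖gradient f xs‖) * ConstrainedSynthesis.rhoSyn m L ^ k := by
  open ConstrainedSynthesis in
  have hLm : 0 < L + m := by linarith
  have h0 : 0 ≤ rho m L := div_nonneg (by linarith) hLm.le
  have h1 : rho m L < 1 := (div_lt_one hLm).2 (by linarith)
  obtain ⟨b, μ, hb, hμ⟩ := exists_orthonormalBasis_eigenvalues hE
  have hμ' (i : Fin n) : μ i = 0 ∨ 1 - rho m L < μ i ∧ μ i ≤ 1 := by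
    refine or_iff_not_imp_left.2 fun hi => ?_
    obtain ⟨j, hj⟩ := hμ i
    obtain ⟨h2, h3⟩ := hj ▸ hσ j (hj ▸ hi)
    refine ⟨lt_of_le_of_lt ?_ h2, h3⟩
    have hL : 0 < L := by linarith
    have e1 : 1 - rho m L = 2 * m / (L + m) := by
      unfold rho
      field_simp
      ring
    have e2 : 2 / (L / m) = 2 * m / L := by field_simp
    rw [e1, e2]
    gcongr
    linarith
  rw [rhoSyn_eq_rho hm hmL]
  have h2 : 0 < 1 - rho m L := sub_pos.2 h1
  refine ⟨h0, h1, √(∑ i, initialModeBound (rho m L) (μ i) (1 + 2 / (L + m))) + 1 / (1 - rho m L),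
    ?_, fun f hf => ?_⟩
  · positivity
  · obtain ⟨xs, hxs, hg⟩ := exists_mem_ker_inner_gradient_eq_zero hm hmL hf
      (LinearMap.ker (Matrix.toEuclideanLin E))
    have hsol := isSolution_of_inner_gradient_eq_zero hm hf hxs hg
    refine ⟨xs, hsol, fun z hz => hsol.unique hm hf hz, fun x0 k => ?_⟩
    refine norm_iterate_sub_le hm hmL hf hb h0 h1 hμ' (fun i hi => ?_) (fun i hi => ?_) x0 k
    · rw [real_inner_comm]
      refine hg _ (LinearMap.mem_ker.2 (b.repr.injective ?_))
      ext j
      rw [b.repr_apply_apply, hb, map_zero, PiLp.zero_apply]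
      rcases eq_or_ne j i with rfl | hji
      · rw [hi, zero_mul]
      · rw [b.inner_eq_zero hji, mul_zero]
    · have h3 := hb i xs
      rw [LinearMap.mem_ker.1 hxs, inner_zero_right] at h3
      exact (mul_eq_zero.1 h3.symm).resolve_left hi
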